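/- Let $p$ and $\ell$ be distinct odd primes, let $m\ge 1$ and $n\ge 0$ be integers, and let $\mathbb F_q$ be a finite field of characteristic $p$ with $q$ elements. A linear code $C\subseteq\mathbb F_q^N$ is negacyclic if $(-c_{N-1},c_0,\dots,c_{N-2})\in C$ for every $(c_0,\dots,c_{N-1})\in C$, and self-dual if it equals its dual for the standard Euclidean inner product. A monic divisor $g$ of $X^N+1$ is called the generator polynomial of the negacyclic code $\langle g(X)\rangle$ that consists of all $(c_0,\dots,c_{N-1})$ for which the class of $c_0+c_1X+\dots+c_{N-1}X^{N-1}$ lies in the ideal of $\mathbb F_q[X]/\langle X^N+1\rangle$ generated by $g$. For $t\in\mathbb Z/\ell^m\mathbb Z$ let $C_t=\{tq^j : j\ge 0\}$ be its $q$-cyclotomic coset modulo $\ell^m$. Let $e$ be the number of $q$-cyclotomic cosets modulo $\ell^m$ other than $\{0\}$, and let $\rho_0=0,\rho_1,\dots,\rho_e$ be such that $C_{\rho_0},\dots,C_{\rho_e}$ are all the distinct cosets. Let $\eta$ be a primitive $\ell^m$-th root of unity in an extension field of $\mathbb F_q$, let $M_t(X)$ be the minimal polynomial of $\eta^t$ over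 $\mathbb F_q$, and for a nonzero polynomial $f$ let $\hat f$ be $f$ divided by its leading coefficient; $\hat M_t(\beta X)$ means this normalization of the polynomial $M_t(\beta X)$. (i) If $q\equiv 1 \pmod 4$, then there are exactly $(p^n+1)^{e+1}$ self-dual negacyclic codes of length $2\ell^mp^n$ over $\mathbb F_q$. Moreover there are a primitive fourth root of unity $\gamma\in\mathbb F_q$ and an element $\beta\in\mathbb F_q$ with $\beta^{\ell^m}\gamma=1$ and $\beta^{-1}=-\beta$, and for any such $\gamma,\beta$ (and any $\eta$ and $\rho_0,\dots,\rho_e$ as above) the self-dual negacyclic codes of length $2\ell^mp^n$ over $\mathbb F_q$ are exactly the codes with generator polynomial $$\prod_{i=0}^{e}\hat M_{\rho_i}(\beta X)^{\varepsilon_i}\,\hat M_{-\rho_i}(-\beta X)^{p^n-\varepsilon_i},\qquad 0\le\varepsilon_i\le p^n\quad(0\le i\le e),$$ each of them for exactly one tuple $(\varepsilon_0,\dots,\varepsilon_e)$. (ii) If $q\equiv 3\pmod 4$, then there is no self-dual negacyclic code of length $2\ell^mp^n$ over $\mathbb F_q$. -/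

import Mathlib

open Polynomial

/-- The `q`-cyclotomic coset `C_t = {t, tq, tq², …}` of `t` modulo `N`. -/
def cyclotomicCoset (q N : ℕ) (t : ZMod N) : Set (ZMod N) :=
  {x | ∃ j : ℕ, x = t * (q : ZMod N) ^ j}

/-- The number `e` of `q`-cyclotomic cosets modulo `N` other than `{0}`. -/
noncomputable def nonzeroCosetCount (q N : ℕ) : ℕ :=
  Set.ncard {S : Set (ZMod N) | (∃ t, S = cyclotomicCoset q N t) ∧ S ≠ {0}}

/-- `ρ 0 = 0`, and `C_{ρ 0}, C_{ρ 1}, …` are all the distinct `q`-cyclotomic cosets modulo `N`: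
every residue class lies in exactly one of them. -/
def IsCosetSystem (q N : ℕ) {e : ℕ} (ρ : Fin (e + 1) → ZMod N) : Prop :=
  ρ 0 = 0 ∧ ∀ t : ZMod N, ∃! i, t ∈ cyclotomicCoset q N (ρ i)

/-- `M_t(X)`: the minimal polynomial over `F` of `η ^ t`, where `t` is a residue class modulo `N`
and `η` is (in the applications) a primitive `N`-th root of unity. -/
noncomputable def cosetPoly (F : Type*) {K : Type*} [Field F] [Field K] [Algebra F K]
    {N : ℕ} (η : K) (t : ZMod N) : F[X] :=
  minpoly F (η ^ t.val)

/-- `f̂`: the polynomial `f` divided by its leading coefficient. -/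
noncomputable def monicHat {F : Type*} [Field F] (f : F[X]) : F[X] :=
  C (f.leadingCoeff)⁻¹ * f

/-- The constacyclic shift `(c₀, …, c_{N-1}) ↦ (a c_{N-1}, c₀, …, c_{N-2})`. -/
def constacyclicShift {F : Type*} [Field F] {N : ℕ} (a : F) (c : Fin N → F) : Fin N → F :=
  fun i => if i.val = 0 then a * c ⟨N - 1, by have := i.isLt; omega⟩
    else c ⟨i.val - 1, by have := i.isLt; omega⟩

/-- A linear code is `a`-constacyclic if it is closed under the `a`-constacyclic shift. -/
def IsConstacyclic {F : Type*} [Field F] {N : ℕ} (a : F) (D : Submodule F (Fin N → F)) : Prop :=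
  ∀ c ∈ D, constacyclicShift a c ∈ D

/-- A negacyclic code is a `(-1)`-constacyclic code. -/
def IsNegacyclic {F : Type*} [Field F] {N : ℕ} (D : Submodule F (Fin N → F)) : Prop :=
  IsConstacyclic (-1) D

/-- The Euclidean dual code. -/
def dualCode {F : Type*} [Field F] {N : ℕ} (D : Submodule F (Fin N → F)) :
    Submodule F (Fin N → F) where
  carrier := {u | ∀ v ∈ D, u ⬝ᵥ v = 0}
  add_mem' := by
    intro a b ha hb v hv
    rw [add_dotProduct, ha v hv, hb v hv, add_zero]
  zero_mem' := by
    intro v _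
    exact zero_dotProduct v
  smul_mem' := by
    intro a u hu v hv
    rw [smul_dotProduct, hu v hv, smul_zero]

/-- A code is self-dual if it equals its dual. -/
def IsSelfDual {F : Type*} [Field F] {N : ℕ} (D : Submodule F (Fin N → F)) : Prop :=
  D = dualCode D

/-- The identification of a word `(c₀, …, c_{N-1})` with the class of `c₀ + c₁X + ⋯` in
`F[X]/(X^N - a)`. -/
noncomputable def wordToQuotient {F : Type*} [Field F] (N : ℕ) (a : F) :
    (Fin N → F) →ₗ[F] AdjoinRoot (X ^ N - C a : F[X]) :=
  Fintype.linearCombination F (fun i : Fin N => AdjoinRoot.root (X ^ N - C a : F[X]) ^ i.val)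

/-- The code `⟨g(X)⟩`: all words whose class lies in the ideal of `F[X]/(X^N - a)` that is
generated by the class of `g`. -/
noncomputable def polyCode {F : Type*} [Field F] (N : ℕ) (a : F) (g : F[X]) :
    Submodule F (Fin N → F) :=
  ((Ideal.span {AdjoinRoot.mk (X ^ N - C a : F[X]) g}).restrictScalars F).comap
    (wordToQuotient N a)

/-- `g` is the generator polynomial of the `a`-constacyclic code `D`: it is a monic divisor of
`X^N - a` and `D = ⟨g(X)⟩`. -/
def IsGeneratorPoly {F : Type*} [Field F] {N : ℕ} (a : F) (D : Submodule F (Fin N → F))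
    (g : F[X]) : Prop :=
  g.Monic ∧ g ∣ X ^ N - C a ∧ D = polyCode N a g

/-- `∏ i, M̂_{ρ i}(βX)^{ε i} · M̂_{-ρ i}(-βX)^{b - ε i}`. -/
noncomputable def selfDualGenerator {F K : Type*} [Field F] [Field K] [Algebra F K] {N e : ℕ}
    (η : K) (ρ : Fin (e + 1) → ZMod N) (β : F) (b : ℕ) (ε : Fin (e + 1) → ℕ) : F[X] :=
  ∏ i, monicHat ((cosetPoly F η (ρ i)).comp (C β * X)) ^ ε i *
    monicHat ((cosetPoly F η (-ρ i)).comp (C (-β) * X)) ^ (b - ε i)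

/-! Writing words as polynomials, an `a`-constacyclic code of length `L` is `⟨g⟩` for a unique monic
`g ∣ X ^ L - a`, because `F[X]` is principal. If `a ^ 2 = 1`, a word `u` is orthogonal to `⟨g⟩`
exactly when `X ^ L - a ∣ u * g.reverse` (`mem_dualCode_polyCode`), so `⟨g⟩` is self-dual iff `g *
g.reverse` equals `X ^ L - a` up to a unit (`isSelfDual_polyCode_iff`). Self-duality thus becomes a
question about how reversal acts on irreducible factors.

Put `N = ℓ ^ m`. In characteristic `p`, `X ^ (2Np^n) + 1 = (X ^ (2N) + 1) ^ p ^ n`, and `X ^ (2N) +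
1` is squarefree.

If `q ≡ 1 mod 4`, take `β ^ 2 = -1`. With `δ = β⁻ᴺ`, `X ^ (2N) + 1 = (X ^ N - δ)(X ^ N + δ)`, and
substituting `±βX` into `X ^ N - 1 = ∏ M_{ρ i}` factors both halves into irreducibles
(`prod_cosetFactor`). A root `-βη^ρ` of `M_ρ(βX)` has inverse `βη^{-ρ}`, a root of `M_{-ρ}(-βX)`, so
reversal swaps the factors in `e + 1` pairs (`associated_reverse_cosetFactor`). Self-duality says
that the two exponents in each pair add up to `p ^ n`, leaving `p ^ n + 1` choices per pair.

If `q ≡ 3 mod 4`, `X ^ 2 + 1` is irreducible and fixed by reversal, so its multiplicity in `g *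
g.reverse` is even; in `X ^ (2Np^n) + 1` it is the odd number `p ^ n`. -/

/-! ### Constacyclic codes as ideals and their generator polynomials -/

section Words

variable {F : Type*} [Field F] {N : ℕ}

/-- The polynomial `c₀ + c₁X + ⋯ + c_{N-1}X^{N-1}` of a word. -/
noncomputable def wordPoly (c : Fin N → F) : F[X] := ∑ i : Fin N, C (c i) * X ^ (i : ℕ)

theorem coeff_wordPoly (c : Fin N → F) (k : ℕ) :
    (wordPoly c).coeff k = if h : k < N then c ⟨k, h⟩ else 0 := by
  simp only [wordPoly, finsetSum_coeff, coeff_C_mul, coeff_X_pow, mul_ite, mul_one, mul_zero]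
  split_ifs with h
  · rw [Finset.sum_eq_single ⟨k, h⟩]
    · simp
    · intro b _ hb
      rw [if_neg]
      rintro rfl
      exact hb rfl
    · simp
  · refine Finset.sum_eq_zero fun i _ => if_neg ?_
    have := i.isLt
    omega

theorem coeff_wordPoly_fin (c : Fin N → F) (i : Fin N) : (wordPoly c).coeff i = c i := by
  rw [coeff_wordPoly, dif_pos i.isLt]

theorem degree_wordPoly_lt (c : Fin N → F) : (wordPoly c).degree < N := by
  rw [degree_lt_iff_coeff_zero]
  intro k hk
  rw [coeff_wordPoly, dif_neg (by omega)]

theorem wordPoly_coeff {P : F[X]} (hP : P.degree < N) :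
    wordPoly (fun i : Fin N => P.coeff i) = P := by
  ext k
  rw [coeff_wordPoly]
  split_ifs with h
  · rfl
  · exact ((degree_lt_iff_coeff_zero _ _).1 hP k (by omega)).symm

theorem wordPoly_injective : Function.Injective (wordPoly : (Fin N → F) → F[X]) := by
  intro c d h
  funext i
  rw [← coeff_wordPoly_fin c, h, coeff_wordPoly_fin]

theorem wordPoly_add (c d : Fin N → F) : wordPoly (c + d) = wordPoly c + wordPoly d := by
  simp [wordPoly, add_mul, Finset.sum_add_distrib]

theorem wordPoly_smul (a : F) (c : Fin N → F) : wordPoly (a • c) = C a * wordPoly c := by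
  simp [wordPoly, Finset.mul_sum, mul_assoc]

theorem wordToQuotient_eq_mk (a : F) (c : Fin N → F) :
    wordToQuotient N a c = AdjoinRoot.mk (X ^ N - C a) (wordPoly c) := by
  simp [wordToQuotient, Fintype.linearCombination_apply, wordPoly, Algebra.smul_def]

theorem mem_polyCode {a : F} {g : F[X]} (hg : g ∣ X ^ N - C a) (c : Fin N → F) :
    c ∈ polyCode N a g ↔ g ∣ wordPoly c := by
  rw [polyCode, Submodule.mem_comap, Submodule.restrictScalars_mem, wordToQuotient_eq_mk,
    Ideal.mem_span_singleton]
  constructor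
  · rintro ⟨r, hr⟩
    obtain ⟨s, rfl⟩ := AdjoinRoot.mk_surjective r
    rw [← map_mul, AdjoinRoot.mk_eq_mk] at hr
    have := (hg.trans hr).add (dvd_mul_right g s)
    rwa [sub_add_cancel] at this
  · exact fun h => map_dvd _ h

/-- The shift is multiplication by `X` modulo `X ^ N - a`: the term pushed up to degree `N` returns
as a constant, multiplied by `a`. -/
theorem wordPoly_constacyclicShift (hN : 0 < N) (a : F) (c : Fin N → F) :
    wordPoly (constacyclicShift a c) =
      X * wordPoly c - C (c ⟨N - 1, by omega⟩) * (X ^ N - C a) := by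
  ext k
  rw [coeff_sub, coeff_C_mul, coeff_sub, coeff_X_pow, coeff_C, coeff_wordPoly]
  rcases k with _ | k
  · simp [constacyclicShift, hN, hN.ne, mul_comm]
  · rw [coeff_X_mul, coeff_wordPoly]
    rcases lt_trichotomy (k + 1) N with h | h | h
    · simp [constacyclicShift, h, h.ne, show k < N by omega]
    · subst h
      simp
    · rw [dif_neg (by omega), dif_neg (by omega)]
      simp [h.ne']

/-- The ideal of all polynomials whose remainder modulo `X ^ N - a` is the polynomial of a word
of a constacyclic code. -/
noncomputable def codeIdeal (hN : 0 < N) (a : F) (D : Submodule F (Fin N → F))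
    (hD : IsConstacyclic a D) : Ideal F[X] where
  carrier := {P | ∃ c ∈ D, (X ^ N - C a) ∣ P - wordPoly c}
  zero_mem' := ⟨0, D.zero_mem, by simp [wordPoly]⟩
  add_mem' := by
    rintro P Q ⟨c, hc, hP⟩ ⟨d, hd, hQ⟩
    refine ⟨c + d, D.add_mem hc hd, ?_⟩
    rw [wordPoly_add, add_sub_add_comm]
    exact hP.add hQ
  smul_mem' := by
    intro R P hP
    rw [smul_eq_mul]
    induction R using Polynomial.induction_on' generalizing P with
    | add R S hR hS =>
      obtain ⟨c, hc, h1⟩ := hR hP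
      obtain ⟨d, hd, h2⟩ := hS hP
      refine ⟨c + d, D.add_mem hc hd, ?_⟩
      rw [wordPoly_add, add_mul, add_sub_add_comm]
      exact h1.add h2
    | monomial k b =>
      obtain ⟨c, hc, h⟩ := hP
      induction k generalizing P c with
      | zero =>
        refine ⟨b • c, D.smul_mem b hc, ?_⟩
        rw [wordPoly_smul, monomial_zero_left, ← mul_sub]
        exact h.mul_left _
      | succ k ih =>
        rw [← monomial_mul_X, mul_assoc]
        refine ih (constacyclicShift a c) (hD c hc) ?_
        rw [wordPoly_constacyclicShift hN, ← sub_add, ← mul_sub]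
        exact (h.mul_left _).add (dvd_mul_left _ _)

theorem mem_codeIdeal_wordPoly (hN : 0 < N) {a : F} {D : Submodule F (Fin N → F)}
    (hD : IsConstacyclic a D) (c : Fin N → F) :
    wordPoly c ∈ codeIdeal hN a D hD ↔ c ∈ D := by
  refine ⟨?_, fun hc => ⟨c, hc, by simp⟩⟩
  rintro ⟨d, hd, h⟩
  have h0 : wordPoly c - wordPoly d = 0 := by
    refine eq_zero_of_dvd_of_degree_lt h ?_
    rw [degree_X_pow_sub_C hN]
    exact (degree_sub_le _ _).trans_lt (max_lt (degree_wordPoly_lt c) (degree_wordPoly_lt d))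
  rwa [wordPoly_injective (sub_eq_zero.1 h0)]

theorem exists_isGeneratorPoly (hN : 0 < N) {a : F} {D : Submodule F (Fin N → F)}
    (hD : IsConstacyclic a D) : ∃ g, IsGeneratorPoly a D g := by
  classical
  have hf : (X ^ N - C a) ∈ codeIdeal hN a D hD := ⟨0, D.zero_mem, by simp [wordPoly]⟩
  obtain ⟨g₀, hg₀⟩ := (IsPrincipalIdealRing.principal (codeIdeal hN a D hD)).principal
  have hI : ∀ P, P ∈ codeIdeal hN a D hD ↔ normalize g₀ ∣ P := by
    intro P
    rw [hg₀, normalize_dvd_iff]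
    exact Ideal.mem_span_singleton
  have hg0 : g₀ ≠ 0 := by
    rintro rfl
    have := (hI _).1 hf
    rw [normalize_zero, zero_dvd_iff] at this
    exact (monic_X_pow_sub_C a hN.ne').ne_zero this
  refine ⟨normalize g₀, monic_normalize hg0, (hI _).1 hf, ?_⟩
  ext c
  rw [mem_polyCode ((hI _).1 hf), ← hI, mem_codeIdeal_wordPoly]

theorem isConstacyclic_polyCode (hN : 0 < N) {a : F} {g : F[X]} (hg : g ∣ X ^ N - C a) :
    IsConstacyclic a (polyCode N a g) := by
  intro c hc
  rw [mem_polyCode hg] at hc ⊢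
  rw [wordPoly_constacyclicShift hN]
  exact dvd_sub (hc.mul_left _) (hg.mul_left _)

theorem exists_word_dvd_sub (hN : 0 < N) (a : F) (P : F[X]) :
    ∃ c : Fin N → F, (X ^ N - C a) ∣ P - wordPoly c := by
  have hm := monic_X_pow_sub_C a hN.ne'
  have hd : (P %ₘ (X ^ N - C a)).degree < N := by
    rw [← degree_X_pow_sub_C hN a]
    exact degree_modByMonic_lt _ hm
  refine ⟨fun i => (P %ₘ (X ^ N - C a)).coeff i, ?_⟩
  rw [wordPoly_coeff hd]
  exact dvd_sub_comm.1 (modByMonic_eq_sub_mul_div P (X ^ N - C a) ▸ by simp)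

theorem polyCode_le_polyCode_iff (hN : 0 < N) {a : F} {g h : F[X]} (hg : g ∣ X ^ N - C a)
    (hh : h ∣ X ^ N - C a) : polyCode N a g ≤ polyCode N a h ↔ h ∣ g := by
  constructor
  · intro hle
    -- `g` may have degree `N`, hence not be a word, so its remainder stands in for it.
    obtain ⟨c, hc⟩ := exists_word_dvd_sub hN a g
    have h1 : c ∈ polyCode N a g :=
      (mem_polyCode hg c).2 ((dvd_iff_dvd_of_dvd_sub (hg.trans hc)).1 dvd_rfl)
    exact (dvd_iff_dvd_of_dvd_sub (hh.trans hc)).2 ((mem_polyCode hh c).1 (hle h1))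
  · intro hd c hc
    rw [mem_polyCode hg] at hc
    exact (mem_polyCode hh c).2 (hd.trans hc)

theorem eq_of_isGeneratorPoly {L : ℕ} (hL : 0 < L) {a : F} {D : Submodule F (Fin L → F)}
    {g h : F[X]} (hg : IsGeneratorPoly a D g) (hh : IsGeneratorPoly a D h) : g = h := by
  obtain ⟨hgm, hgd, rfl⟩ := hg
  obtain ⟨hhm, hhd, hD⟩ := hh
  exact eq_of_monic_of_associated hgm hhm (associated_of_dvd_dvd
    ((polyCode_le_polyCode_iff hL hhd hgd).1 hD.ge) ((polyCode_le_polyCode_iff hL hgd hhd).1 hD.le))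

end Words

/-! ### The Euclidean dual through polynomial reversal -/

section Duality

variable {F : Type*} [Field F] {N : ℕ}

theorem dotProduct_eq_coeff (u v : Fin N → F) :
    u ⬝ᵥ v = (wordPoly u * (wordPoly v).reflect (N - 1)).coeff (N - 1) := by
  have h : ∀ i : Fin N, (C (u i) * X ^ (i : ℕ) * (wordPoly v).reflect (N - 1)).coeff (N - 1) =
      u i * v i := by
    intro i
    have hi : N - 1 = N - 1 - i + i := by have := i.isLt; omega
    have hr : revAt (N - 1) (N - 1 - i) = i := by
      rw [revAt_le (by omega)]
      omega
    rw [mul_assoc, coeff_C_mul, mul_comm (X ^ (i : ℕ))]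
    nth_rw 2 [hi]
    rw [coeff_mul_X_pow, coeff_reflect, hr, coeff_wordPoly_fin]
  rw [wordPoly, Finset.sum_mul, finsetSum_coeff]
  exact Finset.sum_congr rfl fun i _ => (h i).symm

theorem natDegree_wordPoly_le (c : Fin N → F) : (wordPoly c).natDegree ≤ N - 1 :=
  natDegree_le_iff_coeff_eq_zero.2 fun k hk =>
    (degree_lt_iff_coeff_zero _ _).1 (degree_wordPoly_lt c) k (by omega)

/-- The cofactor `Q` has degree at most `N - 2`, so neither `X ^ N * Q` nor `a * Q` has a term in
degree `N - 1`. -/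
theorem coeff_eq_zero_of_X_pow_sub_C_dvd (hN : 0 < N) {a : F} {P : F[X]}
    (hP : P.natDegree ≤ 2 * N - 2) (h : (X ^ N - C a) ∣ P) : P.coeff (N - 1) = 0 := by
  obtain ⟨Q, rfl⟩ := h
  rcases eq_or_ne Q 0 with rfl | hQ
  · simp
  have hm := monic_X_pow_sub_C a hN.ne'
  rw [hm.natDegree_mul' hQ, natDegree_X_pow_sub_C] at hP
  rw [sub_mul, coeff_sub, coeff_C_mul, coeff_X_pow_mul', if_neg (by omega),
    coeff_eq_zero_of_natDegree_lt (by omega : Q.natDegree < N - 1)]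
  simp

theorem natDegree_reflect_le_self {n : ℕ} {P : F[X]} (h : P.natDegree ≤ n) :
    (P.reflect n).natDegree ≤ n :=
  natDegree_reflect_le.trans (max_le le_rfl h)

theorem reverse_reverse_of_coeff_zero {P : F[X]} (h : P.coeff 0 ≠ 0) :
    P.reverse.reverse = P := by
  have hd : P.reverse.natDegree = P.natDegree := by
    rw [reverse_natDegree, natTrailingDegree_eq_zero.2 (Or.inr h), Nat.sub_zero]
  rw [reverse, hd, reverse, reflect_reflect]

theorem reverse_dvd_reflect {n : ℕ} {g P : F[X]} (hP : P.natDegree ≤ n) (h : g ∣ P) :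
    g.reverse ∣ P.reflect n := by
  obtain ⟨Q, rfl⟩ := h
  rcases eq_or_ne g 0 with rfl | hg
  · simp
  rcases eq_or_ne Q 0 with rfl | hQ
  · simp
  rw [natDegree_mul hg hQ] at hP
  obtain ⟨k, rfl⟩ := Nat.exists_eq_add_of_le ((Nat.le_add_right _ _).trans hP)
  rw [reflect_mul _ _ le_rfl (by omega : Q.natDegree ≤ k)]
  exact dvd_mul_right _ _

theorem coeff_zero_ne_zero_of_dvd_X_pow_sub_C (hN : 0 < N) {a : F} (ha : a ≠ 0) {g : F[X]}
    (hg : g ∣ X ^ N - C a) : g.coeff 0 ≠ 0 := by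
  obtain ⟨h, hh⟩ := hg
  intro h0
  have := congrArg (fun P => coeff P 0) hh
  simp [mul_coeff_zero, h0, hN.ne, ha] at this

theorem reverse_dvd_X_pow_sub_C {a : F} (ha : a * a = 1) {g : F[X]} (hg : g ∣ X ^ N - C a) :
    g.reverse ∣ X ^ N - C a := by
  have h := reverse_dvd_reflect (n := N) (by rw [natDegree_X_pow_sub_C]) hg
  rw [reflect_sub, reflect_C, reflect_monomial, revAt_le le_rfl, Nat.sub_self, pow_zero] at h
  have h1 : (C a : F[X]) * C a = 1 := by rw [← C_mul, ha, C_1]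
  have h2 : C (-a) * (1 - C a * X ^ N) = X ^ N - C a := by
    rw [C_neg]
    linear_combination X ^ N * h1
  exact h2 ▸ h.mul_left (C (-a))

/-- Reading off the coefficient of degree `N - 1` is a nondegenerate functional on the quotient
ring: a power of `X` lifts the leading term of a nonzero remainder to that degree. -/
theorem X_pow_sub_C_dvd_of_coeff (hN : 0 < N) {a : F} {P : F[X]}
    (h : ∀ (j : ℕ) (R : F[X]), R.degree < N → (X ^ N - C a) ∣ P * X ^ j - R →
      R.coeff (N - 1) = 0) : (X ^ N - C a) ∣ P := by
  have hm := monic_X_pow_sub_C a hN.ne'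
  obtain ⟨c, hc⟩ := exists_word_dvd_sub hN a P
  rw [dvd_iff_dvd_of_dvd_sub hc]
  by_contra hne
  have h0 : wordPoly c ≠ 0 := fun h => hne (h ▸ dvd_zero _)
  have hd := natDegree_wordPoly_le c
  have hj := h (N - 1 - (wordPoly c).natDegree)
    (wordPoly c * X ^ (N - 1 - (wordPoly c).natDegree)) (by
      rw [degree_lt_iff_coeff_zero]
      intro k hk
      refine coeff_eq_zero_of_natDegree_lt ?_
      rw [natDegree_mul_X_pow _ h0]
      omega) (by rw [← sub_mul]; exact hc.mul_right _)
  nth_rw 2 [show N - 1 = (wordPoly c).natDegree + (N - 1 - (wordPoly c).natDegree) by omega] at hj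
  rw [coeff_mul_X_pow] at hj
  exact h0 (leadingCoeff_eq_zero.1 hj)

theorem mem_dualCode_polyCode (hN : 0 < N) {a : F} (ha : a * a = 1) {g : F[X]}
    (hg : g ∣ X ^ N - C a) (u : Fin N → F) :
    u ∈ dualCode (polyCode N a g) ↔ (X ^ N - C a) ∣ wordPoly u * g.reverse := by
  have hg0 := coeff_zero_ne_zero_of_dvd_X_pow_sub_C hN (left_ne_zero_of_mul_eq_one ha) hg
  constructor
  · intro hu
    refine X_pow_sub_C_dvd_of_coeff hN fun j R hR hd => ?_
    -- The reflection of this `c` is divisible by `g`, hence a codeword; pairing it with `u` gives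
    -- the coefficient of degree `N - 1` of `u * c`.
    obtain ⟨c, hc⟩ := exists_word_dvd_sub hN a (g.reverse * X ^ j)
    have hgr := reverse_dvd_X_pow_sub_C ha hg
    have hgc : g.reverse ∣ wordPoly c :=
      (dvd_iff_dvd_of_dvd_sub (hgr.trans hc)).1 (dvd_mul_right _ _)
    have hv := reverse_dvd_reflect (natDegree_wordPoly_le c) hgc
    rw [reverse_reverse_of_coeff_zero hg0] at hv
    have hvd := natDegree_reflect_le_self (natDegree_wordPoly_le c)
    have hv' : ((wordPoly c).reflect (N - 1)).degree < N := by
      rw [degree_lt_iff_coeff_zero]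
      intro k hk
      exact coeff_eq_zero_of_natDegree_lt (by omega)
    have hdot := hu (fun i : Fin N => ((wordPoly c).reflect (N - 1)).coeff i)
      ((mem_polyCode hg _).2 (by rwa [wordPoly_coeff hv']))
    rw [dotProduct_eq_coeff, wordPoly_coeff hv', reflect_reflect] at hdot
    have hRd : R.natDegree ≤ N - 1 := natDegree_le_iff_coeff_eq_zero.2 fun k hk =>
      (degree_lt_iff_coeff_zero _ _).1 hR k (by omega)
    have hz := coeff_eq_zero_of_X_pow_sub_C_dvd hN (a := a) (P := wordPoly u * wordPoly c - R)
      ((natDegree_sub_le _ _).trans (max_le (natDegree_mul_le.trans (by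
        have := natDegree_wordPoly_le u
        have := natDegree_wordPoly_le c
        omega)) (by omega))) (by
        have := dvd_sub hd (hc.mul_left (wordPoly u))
        convert this using 1
        ring)
    rw [coeff_sub, hdot, zero_sub, neg_eq_zero] at hz
    exact hz
  · intro hd v hv
    rw [mem_polyCode hg] at hv
    have hr := reverse_dvd_reflect (natDegree_wordPoly_le v) hv
    rw [dotProduct_eq_coeff]
    refine coeff_eq_zero_of_X_pow_sub_C_dvd hN (a := a) (natDegree_mul_le.trans ?_)
      (hd.trans (mul_dvd_mul_left _ hr))
    have := natDegree_wordPoly_le u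
    have := natDegree_reflect_le_self (natDegree_wordPoly_le v)
    omega

theorem isSelfDual_polyCode_iff (hN : 0 < N) {a : F} (ha : a * a = 1) {g : F[X]}
    (hg : g ∣ X ^ N - C a) :
    IsSelfDual (polyCode N a g) ↔ Associated (g * g.reverse) (X ^ N - C a) := by
  have hm := monic_X_pow_sub_C a hN.ne'
  have key : IsSelfDual (polyCode N a g) ↔ ∀ P, g ∣ P ↔ (X ^ N - C a) ∣ P * g.reverse := by
    rw [IsSelfDual, SetLike.ext_iff]
    simp_rw [mem_dualCode_polyCode hN ha hg, mem_polyCode hg]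
    refine ⟨fun h P => ?_, fun h c => h _⟩
    obtain ⟨c, hc⟩ := exists_word_dvd_sub hN a P
    rw [dvd_iff_dvd_of_dvd_sub (hg.trans hc), h c]
    refine (dvd_iff_dvd_of_dvd_sub ?_).symm
    rw [← sub_mul]
    exact hc.mul_right _
  rw [key]
  constructor
  · intro h
    have h1 := (h g).1 dvd_rfl
    refine associated_of_dvd_dvd ?_ h1
    -- The cofactor `q` of `g.reverse` satisfies the dual condition, so `g ∣ q`.
    obtain ⟨q, hq⟩ := reverse_dvd_X_pow_sub_C ha hg
    have := (h q).2 (by rw [hq, mul_comm])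
    rw [hq, mul_comm]
    exact mul_dvd_mul_left _ this
  · intro h P
    have hr : g.reverse ≠ 0 := by
      intro h0
      rw [h0, mul_zero] at h
      exact hm.ne_zero (h.symm.eq_zero_iff.2 rfl)
    rw [← h.dvd_iff_dvd_left, mul_dvd_mul_iff_right hr]

end Duality

/-! ### Cyclotomic cosets and the factorization of `X ^ N - 1` -/

section Cosets

theorem neg_mem_cyclotomicCoset_iff (q N : ℕ) (s t : ZMod N) :
    -t ∈ cyclotomicCoset q N s ↔ t ∈ cyclotomicCoset q N (-s) := by
  refine exists_congr fun j => ?_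
  rw [neg_mul, neg_eq_iff_eq_neg]

theorem IsCosetSystem.neg {q N e : ℕ} {ρ : Fin (e + 1) → ZMod N} (h : IsCosetSystem q N ρ) :
    IsCosetSystem q N (fun i => -ρ i) := by
  refine ⟨by simp [h.1], fun t => ?_⟩
  simp_rw [← neg_mem_cyclotomicCoset_iff]
  exact h.2 (-t)

theorem IsPrimitiveRoot.pow_val_eq_pow_iff {K : Type*} [Field K] {N : ℕ} [NeZero N] {η : K}
    (hη : IsPrimitiveRoot η N) (x : ZMod N) (k : ℕ) : η ^ x.val = η ^ k ↔ x = k := by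
  have hfin : IsOfFinOrder η := isOfFinOrder_iff_pow_eq_one.2 ⟨N, NeZero.pos N, hη.pow_eq_one⟩
  rw [hfin.pow_eq_pow_iff_modEq, ← hη.eq_orderOf, ← ZMod.natCast_eq_natCast_iff, ZMod.natCast_zmod_val]

theorem mem_cyclotomicCoset_iff_pow {K : Type*} [Field K] {N : ℕ} [NeZero N] {η : K}
    (hη : IsPrimitiveRoot η N) (q : ℕ) (s t : ZMod N) :
    t ∈ cyclotomicCoset q N s ↔ ∃ j : ℕ, η ^ t.val = (η ^ s.val) ^ q ^ j := by
  refine exists_congr fun j => ?_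
  rw [← pow_mul, hη.pow_val_eq_pow_iff]
  simp

variable {F K : Type*} [Field F] [Fintype F] [Field K] [Algebra F K]

/-- `F(η)` is a finite field, so elements with the same minimal polynomial are Galois conjugate, and
Frobenius generates the Galois group. -/
theorem exists_pow_card_pow_of_minpoly_eq {η : K} (hη : IsIntegral F η) {s t : ℕ}
    (h : minpoly F (η ^ s) = minpoly F (η ^ t)) :
    ∃ j : ℕ, η ^ s = (η ^ t) ^ Fintype.card F ^ j := by
  let L := IntermediateField.adjoin F {η}
  have : FiniteDimensional F L := IntermediateField.adjoin.finiteDimensional hη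
  have : Finite L := Module.finite_of_finite F
  let x : L := IntermediateField.AdjoinSimple.gen F η
  have hx : algebraMap L K x = η := IntermediateField.AdjoinSimple.algebraMap_gen F η
  have hm : ∀ k : ℕ, minpoly F (x ^ k) = minpoly F (η ^ k) := by
    intro k
    rw [← minpoly.algebraMap_eq (algebraMap L K).injective, map_pow, hx]
  rw [← hm, ← hm, Normal.minpoly_eq_iff_mem_orbit L] at h
  obtain ⟨φ, hφ⟩ := h
  obtain ⟨j, rfl⟩ := (FiniteField.bijective_frobeniusAlgEquivOfAlgebraic_pow F L).2 φ
  refine ⟨j, ?_⟩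
  have h2 : (x ^ t) ^ Fintype.card F ^ (j : ℕ) = x ^ s := by
    rw [← hφ]
    simp only [AlgEquiv.smul_def, AlgEquiv.coe_pow,
      FiniteField.coe_frobeniusAlgEquivOfAlgebraic_iterate]
  rw [← hx, ← map_pow, ← map_pow, ← map_pow, h2]

theorem minpoly_pow_card_pow (x : K) (j : ℕ) :
    aeval (x ^ Fintype.card F ^ j) (minpoly F x) = 0 := by
  have h := FiniteField.coe_frobeniusAlgHom F K
  have h2 : x ^ Fintype.card F ^ j = (FiniteField.frobeniusAlgHom F K ^ j) x := by
    rw [AlgHom.coe_pow, h, pow_iterate]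
  rw [h2, aeval_algHom_apply, minpoly.aeval, map_zero]

theorem prod_cosetPoly {N e : ℕ} [NeZero N] {η : K} (hη : IsPrimitiveRoot η N)
    {ρ : Fin (e + 1) → ZMod N} (hρ : IsCosetSystem (Fintype.card F) N ρ) :
    ∏ i, cosetPoly F η (ρ i) = X ^ N - 1 := by
  have hN := NeZero.pos N
  have hint : IsIntegral F η := hη.isIntegral hN |>.tower_top
  have hirr : ∀ i, Irreducible (cosetPoly F η (ρ i)) := fun i => minpoly.irreducible (hint.pow _)
  have hmon : ∀ i, (cosetPoly F η (ρ i)).Monic := fun i => minpoly.monic (hint.pow _)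
  refine eq_of_monic_of_associated (monic_prod_of_monic _ _ fun i _ => hmon i)
    (monic_X_pow_sub_C 1 hN.ne') (associated_of_dvd_dvd ?_ ?_)
  · refine Fintype.prod_dvd_of_isRelPrime (fun i j hij => ?_) fun i => ?_
    · refine (hirr i).isRelPrime_iff_not_dvd.2 fun hd => hij ?_
      have heq := eq_of_monic_of_associated (hmon i) (hmon j)
        ((hirr i).associated_of_dvd (hirr j) hd)
      refine (hρ.2 (ρ i)).unique ⟨0, by simp⟩ ?_
      rw [mem_cyclotomicCoset_iff_pow hη]
      exact exists_pow_card_pow_of_minpoly_eq hint heq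
    · refine minpoly.dvd _ _ ?_
      rw [map_sub, map_pow, aeval_X, map_one, ← pow_mul, mul_comm, pow_mul, hη.pow_eq_one, one_pow,
        sub_self]
  · rw [← map_dvd_map' (algebraMap F K), Polynomial.map_sub, Polynomial.map_pow, map_X,
      Polynomial.map_one, X_pow_sub_one_eq_prod hN hη]
    refine Finset.prod_dvd_of_isRelPrime ?_ fun z hz => ?_
    · intro a _ b _ hab
      exact (pairwise_coprime_X_sub_C Function.injective_id hab).isRelPrime
    · rw [dvd_iff_isRoot, IsRoot.def, eval_map_algebraMap, map_prod]
      obtain ⟨k, hk, rfl⟩ := hη.eq_pow_of_pow_eq_one ((mem_nthRootsFinset hN _).1 hz)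
      obtain ⟨i, hi, -⟩ := hρ.2 (k : ZMod N)
      obtain ⟨j, hj⟩ := (mem_cyclotomicCoset_iff_pow hη _ _ _).1 hi
      rw [(hη.pow_val_eq_pow_iff _ _).2 rfl] at hj
      refine Finset.prod_eq_zero (Finset.mem_univ i) ?_
      rw [hj]
      exact minpoly_pow_card_pow _ _

end Cosets

/-! ### Scaling the variable and reversing irreducible polynomials -/

section Scaling

variable {F : Type*} [Field F]

theorem monic_monicHat {f : F[X]} (hf : f ≠ 0) : (monicHat f).Monic := by
  rw [monicHat, mul_comm]
  exact monic_mul_leadingCoeff_inv hf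

theorem associated_monicHat {f : F[X]} (hf : f ≠ 0) : Associated (monicHat f) f :=
  associated_unit_mul_left _ _ (isUnit_C.2 (inv_ne_zero (leadingCoeff_ne_zero.2 hf)).isUnit)

theorem irreducible_comp_C_mul_X {f : F[X]} (hf : Irreducible f) {c : F} (hc : c ≠ 0) :
    Irreducible (f.comp (C c * X)) := by
  let _ := invertibleOfNonzero hc
  have h := (MulEquiv.irreducible_iff (algEquivCMulXAddC c 0)).2 hf
  simpa [← comp_eq_aeval] using h

theorem associated_prod_monicHat_comp {ι : Type*} [Fintype ι] {M : ι → F[X]}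
    (hM : ∀ i, Irreducible (M i)) {N : ℕ} (hprod : ∏ i, M i = X ^ N - 1) {c d : F}
    (hcd : c ^ N * d = 1) (hc : c ≠ 0) :
    Associated (∏ i, monicHat ((M i).comp (C c * X))) (X ^ N - C d) := by
  have h1 : Associated (∏ i, monicHat ((M i).comp (C c * X))) (∏ i, (M i).comp (C c * X)) :=
    Associated.prod _ _ _ fun i _ => associated_monicHat (irreducible_comp_C_mul_X (hM i) hc).ne_zero
  refine h1.trans ?_
  have h2 : ∏ i, (M i).comp (C c * X) = C (c ^ N) * (X ^ N - C d) := by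
    rw [← prod_comp, hprod, sub_comp, mul_sub, ← C_mul, hcd]
    simp [mul_pow]
  rw [h2]
  exact associated_unit_mul_left _ _ (isUnit_C.2 (pow_ne_zero _ hc).isUnit)

/-- Reversal inverts nonzero roots, so `Q ∣ P.reverse` and `P ∣ Q.reverse`. Since reversal never
raises the degree, the first divisibility is an equality up to a unit. -/
theorem associated_reverse_of_aeval_inv {K : Type*} [Field K] [Algebra F K] {P Q : F[X]}
    (hP : Irreducible P) (hQ : Irreducible Q) {x : K} (hx : x ≠ 0) (hPx : aeval x P = 0)
    (hQx : aeval x⁻¹ Q = 0) : Associated P.reverse Q := by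
  have key : ∀ {P Q : F[X]} {x : K}, Irreducible Q → x ≠ 0 → aeval x P = 0 →
      aeval x⁻¹ Q = 0 → Q ∣ P.reverse := by
    intro P Q x hQ hx hPx hQx
    let _ := invertibleOfNonzero hx
    have hr : aeval x⁻¹ P.reverse = 0 := by
      have := (eval₂_reverse_eq_zero_iff (algebraMap F K) x P).2 hPx
      rwa [invOf_eq_inv] at this
    refine (Dvd.intro _ (minpoly.eq_of_irreducible hQ hQx) : Q ∣ minpoly F x⁻¹).trans ?_
    exact minpoly.dvd _ _ hr
  have h1 := key hQ hx hPx hQx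
  have h2 := key hP (inv_ne_zero hx) hQx (by rwa [inv_inv])
  have hr : P.reverse ≠ 0 := by simpa using hP.ne_zero
  have hr2 : Q.reverse ≠ 0 := by simpa using hQ.ne_zero
  refine (associated_of_dvd_of_natDegree_le h1 hr ?_).symm
  exact (reverse_natDegree_le P).trans ((natDegree_le_of_dvd h2 hr2).trans (reverse_natDegree_le Q))

end Scaling

/-! ### Unique factorization in terms of exponent vectors -/

section Exponents

variable {F : Type*} [Field F] {κ : Type*}

theorem injective_of_squarefree_prod [Fintype κ] {P : κ → F[X]} (hP : ∀ k, Irreducible (P k))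
    (hsq : Squarefree (∏ k, P k)) : Function.Injective P := by
  classical
  intro j k hjk
  by_contra hne
  have h : P j * P j ∣ ∏ k, P k := by
    rw [← Finset.mul_prod_erase _ _ (Finset.mem_univ j)]
    refine mul_dvd_mul_left _ ?_
    rw [hjk]
    exact Finset.dvd_prod_of_mem _ (Finset.mem_erase.2 ⟨Ne.symm hne, Finset.mem_univ k⟩)
  exact (hP j).not_isUnit (hsq _ h)

theorem emultiplicity_prod_pow [Fintype κ] {P : κ → F[X]} (hP : ∀ k, Irreducible (P k))
    (hmon : ∀ k, (P k).Monic) (hinj : Function.Injective P) (a : κ → ℕ) (k : κ) :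
    emultiplicity (P k) (∏ j, P j ^ a j) = a k := by
  rw [Finset.emultiplicity_prod (hP k).prime, Finset.sum_eq_single k]
  · exact emultiplicity_pow_self (hP k).ne_zero (hP k).not_isUnit _
  · intro j _ hj
    rw [emultiplicity_eq_zero]
    intro hd
    exact hj (hinj (eq_of_monic_of_associated (hmon k) (hmon j) ((hP k).associated_of_dvd (hP j)
      ((hP k).prime.dvd_of_dvd_pow hd)))).symm
  · simp

theorem associated_prod_pow_iff [Fintype κ] {P : κ → F[X]} (hP : ∀ k, Irreducible (P k))
    (hmon : ∀ k, (P k).Monic) (hinj : Function.Injective P) (a b : κ → ℕ) :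
    Associated (∏ j, P j ^ a j) (∏ j, P j ^ b j) ↔ a = b := by
  refine ⟨fun h => funext fun k => ?_, fun h => h ▸ Associated.refl _⟩
  have h1 := emultiplicity_prod_pow hP hmon hinj a k
  rw [emultiplicity_eq_of_associated_right h, emultiplicity_prod_pow hP hmon hinj] at h1
  exact_mod_cast h1.symm

theorem exists_eq_prod_pow_of_dvd (s : Finset κ) {P : κ → F[X]} (hP : ∀ k, Irreducible (P k))
    (hmon : ∀ k, (P k).Monic) (b : ℕ) {g : F[X]} (hg : g.Monic) (h : g ∣ ∏ j ∈ s, P j ^ b) :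
    ∃ a : κ → ℕ, (∀ k, a k ≤ b) ∧ g = ∏ j ∈ s, P j ^ a j := by
  classical
  suffices H : ∃ a : κ → ℕ, (∀ k, a k ≤ b) ∧ Associated g (∏ j ∈ s, P j ^ a j) by
    obtain ⟨a, ha, hga⟩ := H
    exact ⟨a, ha, eq_of_monic_of_associated hg
      (monic_prod_of_monic _ _ fun j _ => (hmon j).pow _) hga⟩
  clear hg
  induction s using Finset.induction_on generalizing g with
  | empty => exact ⟨0, by simp, by simpa using associated_one_iff_isUnit.2 (isUnit_of_dvd_one h)⟩
  | insert k s hk ih =>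
    rw [Finset.prod_insert hk] at h
    obtain ⟨g₁, g₂, h1, h2, rfl⟩ := exists_dvd_and_dvd_of_dvd_mul h
    obtain ⟨a, ha, hga⟩ := ih h2
    obtain ⟨i, hi, hgi⟩ := (dvd_prime_pow (hP k).prime b).1 h1
    refine ⟨Function.update a k i, fun j => ?_, ?_⟩
    · rcases eq_or_ne j k with rfl | hj
      · simpa using hi
      · simpa [hj] using ha j
    · rw [Finset.prod_insert hk, Function.update_self]
      refine hgi.mul_mul ?_
      rwa [Finset.prod_congr rfl fun j hj => by
        rw [Function.update_of_ne (ne_of_mem_of_not_mem hj hk)]]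

theorem reverse_pow_of_domain (Q : F[X]) (n : ℕ) : (Q ^ n).reverse = Q.reverse ^ n := by
  induction n with
  | zero => rw [pow_zero, pow_zero, ← C_1, reverse_C]
  | succ n ih => rw [pow_succ, pow_succ, reverse_mul_of_domain, ih]

theorem reverse_prod_pow_associated {ι : Type*} [Fintype ι] {P : ι ⊕ ι → F[X]}
    (hrev : ∀ k, Associated (P k).reverse (P k.swap)) (a : ι ⊕ ι → ℕ) :
    Associated (∏ k, P k ^ a k).reverse (∏ k, P k ^ a k.swap) := by
  have hprod : ∀ (s : Finset (ι ⊕ ι)) (Q : ι ⊕ ι → F[X]),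
      (∏ k ∈ s, Q k).reverse = ∏ k ∈ s, (Q k).reverse := by
    classical
    intro s Q
    induction s using Finset.induction_on with
    | empty => rw [Finset.prod_empty, Finset.prod_empty, ← C_1, reverse_C]
    | insert k s hk ih =>
      rw [Finset.prod_insert hk, Finset.prod_insert hk, reverse_mul_of_domain, ih]
  have h : ∏ k, P k ^ a k.swap = ∏ k : ι ⊕ ι, P k.swap ^ a k :=
    Fintype.prod_equiv (Equiv.sumComm ι ι) _ _ fun k => by simp
  rw [hprod, h]
  refine Associated.prod _ _ _ fun k _ => ?_
  rw [reverse_pow_of_domain]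
  exact (hrev k).pow_pow

end Exponents

/-! ### Existence of coset representatives -/

section CosetSystem

theorem self_mem_cyclotomicCoset (q N : ℕ) (t : ZMod N) : t ∈ cyclotomicCoset q N t :=
  ⟨0, by simp⟩

theorem cyclotomicCoset_zero (q N : ℕ) : cyclotomicCoset q N 0 = {0} := by
  ext x
  simp [cyclotomicCoset]

theorem cyclotomicCoset_eq_of_mem {q N : ℕ} [NeZero N] (hq : q.Coprime N) {s t : ZMod N}
    (h : t ∈ cyclotomicCoset q N s) : cyclotomicCoset q N t = cyclotomicCoset q N s := by
  obtain ⟨j, rfl⟩ := h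
  ext x
  constructor
  · rintro ⟨i, rfl⟩
    exact ⟨j + i, by ring⟩
  · rintro ⟨i, rfl⟩
    have hpos := Nat.totient_pos.2 (NeZero.pos N)
    have h1 : (q : ZMod N) ^ N.totient = 1 := by
      have := (ZMod.natCast_eq_natCast_iff _ _ _).2 (Nat.ModEq.pow_totient hq)
      exact_mod_cast this
    -- By Euler's theorem `q ^ (j * (N.totient - 1))` is the inverse of `q ^ j` modulo `N`.
    refine ⟨j * (N.totient - 1) + i, ?_⟩
    have h2 : j + j * (N.totient - 1) = N.totient * j := by
      obtain ⟨k, hk⟩ := Nat.exists_eq_add_of_le' hpos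
      rw [hk, Nat.add_sub_cancel]
      ring
    rw [mul_assoc, ← pow_add, ← add_assoc, h2, pow_add, pow_mul, h1, one_pow, one_mul]

theorem exists_isCosetSystem {q N : ℕ} [NeZero N] (hq : q.Coprime N) :
    ∃ ρ : Fin (nonzeroCosetCount q N + 1) → ZMod N, IsCosetSystem q N ρ := by
  let S : Set (Set (ZMod N)) := {S | (∃ t, S = cyclotomicCoset q N t) ∧ S ≠ {0}}
  let E : S ≃ Fin (nonzeroCosetCount q N) := Finite.equivFinOfCardEq rfl
  have hrep : ∀ i, ∃ t, ((E.symm i : S) : Set (ZMod N)) = cyclotomicCoset q N t :=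
    fun i => (E.symm i).2.1
  choose r hr using hrep
  refine ⟨Fin.cons 0 r, rfl, fun t => ?_⟩
  rcases eq_or_ne t 0 with rfl | ht
  · refine ⟨0, self_mem_cyclotomicCoset q N 0, fun i hi => ?_⟩
    rcases Fin.eq_zero_or_eq_succ i with rfl | ⟨i, rfl⟩
    · rfl
    · exfalso
      simp only [Fin.cons_succ] at hi
      refine (E.symm i).2.2 ?_
      rw [hr, ← cyclotomicCoset_eq_of_mem hq hi, cyclotomicCoset_zero]
  · have hS : cyclotomicCoset q N t ∈ S := by
      refine ⟨⟨t, rfl⟩, fun h => ht ?_⟩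
      have := self_mem_cyclotomicCoset q N t
      rwa [h] at this
    refine ⟨(E ⟨_, hS⟩).succ, ?_, fun i hi => ?_⟩
    · have h := hr (E ⟨_, hS⟩)
      rw [Equiv.symm_apply_apply] at h
      simp only [Fin.cons_succ]
      rw [← h]
      exact self_mem_cyclotomicCoset q N t
    · rcases Fin.eq_zero_or_eq_succ i with rfl | ⟨i, rfl⟩
      · simp only [Fin.cons_zero, cyclotomicCoset_zero] at hi
        exact absurd hi ht
      · simp only [Fin.cons_succ] at hi
        rw [← E.apply_symm_apply i]
        congr 2
        exact Subtype.ext ((hr i).trans (cyclotomicCoset_eq_of_mem hq hi).symm)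

end CosetSystem

/-! ### Self-duality as a condition on exponents -/

section SelfDual

variable {F : Type*} [Field F]

theorem X_pow_sub_C_neg_one_pow {p n : ℕ} [hp : Fact p.Prime] (hp2 : p ≠ 2) [CharP F p] (M : ℕ) :
    (X ^ M - C (-1) : F[X]) ^ p ^ n = X ^ (M * p ^ n) - C (-1) := by
  have hodd : Odd (p ^ n) := (hp.out.odd_of_ne_two hp2).pow
  rw [sub_pow_char_pow, ← pow_mul, ← C_pow, hodd.neg_one_pow]

theorem two_mul_cast_ne_zero {p N : ℕ} (hp2 : p ≠ 2) [CharP F p] (hN : (N : F) ≠ 0) :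
    ((2 * N : ℕ) : F) ≠ 0 := by
  have h2 : (2 : F) ≠ 0 := Ring.two_ne_zero (by rwa [ringChar.eq F p])
  push_cast
  exact mul_ne_zero h2 hN

theorem length_pos {p n N : ℕ} [hp : Fact p.Prime] (hN : Odd N) : 0 < 2 * N * p ^ n :=
  Nat.mul_pos (Nat.mul_pos two_pos hN.pos) (pow_pos hp.out.pos n)

theorem squarefree_X_pow_sub_C_neg_one {M : ℕ} (hM : (M : F) ≠ 0) :
    Squarefree (X ^ M - C (-1) : F[X]) :=
  (separable_X_pow_sub_C (-1) hM (neg_ne_zero.2 one_ne_zero)).squarefree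

theorem emultiplicity_reverse_le {r g : F[X]} (hr : r.reverse = r) :
    emultiplicity r g ≤ emultiplicity r g.reverse := by
  rw [emultiplicity_le_emultiplicity_iff]
  intro k hk
  have := reverse_dvd_reflect (n := g.natDegree) le_rfl hk
  rwa [reverse_pow_of_domain, hr] at this

theorem not_isSelfDual_of_not_isSquare {p n N : ℕ} [Fact p.Prime] (hp2 : p ≠ 2) [CharP F p]
    (hN : Odd N) (hNF : (N : F) ≠ 0) (hsq : ¬IsSquare (-1 : F))
    {D : Submodule F (Fin (2 * N * p ^ n) → F)} (hD : IsNegacyclic D) : ¬IsSelfDual D := by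
  intro hself
  have hL : 0 < 2 * N * p ^ n := length_pos hN
  obtain ⟨g, hgm, hgd, rfl⟩ := exists_isGeneratorPoly hL hD
  rw [isSelfDual_polyCode_iff hL (by norm_num) hgd, ← X_pow_sub_C_neg_one_pow hp2] at hself
  let r : F[X] := X ^ 2 - C (-1)
  have hr : Irreducible r :=
    X_pow_sub_C_irreducible_of_prime Nat.prime_two fun b hb => hsq ⟨b, by rw [← hb, sq]⟩
  have hrr : r.reverse = r := by
    have hd : r.natDegree = 2 := natDegree_X_pow_sub_C
    rw [reverse, hd, reflect_sub, reflect_C, reflect_monomial, revAt_le le_rfl]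
    simp [r, add_comm]
  -- For odd `N`, `Y + 1` divides `Y ^ N + 1`; here `Y = X ^ 2`.
  have hrd : r ∣ X ^ (2 * N) - C (-1) := by
    have := hN.add_dvd_pow_add_pow (X ^ 2 : F[X]) 1
    simpa [r, pow_mul] using this
  have hr1 : emultiplicity r (X ^ (2 * N) - C (-1)) = 1 := by
    refine le_antisymm ?_ ?_
    · exact ((squarefree_iff_emultiplicity_le_one _).1 (squarefree_X_pow_sub_C_neg_one
        (two_mul_cast_ne_zero hp2 hNF))
        r).resolve_right hr.not_isUnit
    · exact_mod_cast le_emultiplicity_of_pow_dvd (k := 1) (by simpa using hrd)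
  have hg0 := coeff_zero_ne_zero_of_dvd_X_pow_sub_C hL (neg_ne_zero.2 one_ne_zero) hgd
  have heq : emultiplicity r g = emultiplicity r g.reverse := by
    refine le_antisymm (emultiplicity_reverse_le hrr) ?_
    have := emultiplicity_reverse_le (g := g.reverse) hrr
    rwa [reverse_reverse_of_coeff_zero hg0] at this
  have hfin : FiniteMultiplicity r g :=
    FiniteMultiplicity.of_not_isUnit hr.not_isUnit hgm.ne_zero
  have hm := emultiplicity_eq_of_associated_right (a := r) hself
  rw [emultiplicity_mul hr.prime, ← heq, emultiplicity_pow hr.prime, hr1, mul_one,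
    hfin.emultiplicity_eq_multiplicity] at hm
  have hodd : Odd (p ^ n) := ((Fact.out : p.Prime).odd_of_ne_two hp2).pow
  have hm' : multiplicity r g + multiplicity r g = p ^ n := by exact_mod_cast hm
  exact Nat.not_even_iff_odd.2 hodd ⟨_, hm'.symm⟩

/-- For a family of irreducible factors that reversal swaps in pairs, the self-dual codes are
those whose exponents at each pair add up to `b`. -/
theorem isSelfDual_iff_exists_exponents {ι : Type*} [Fintype ι] {P : ι ⊕ ι → F[X]}
    (hP : ∀ k, Irreducible (P k)) (hmon : ∀ k, (P k).Monic) (hinj : Function.Injective P)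
    (hrev : ∀ k, Associated (P k).reverse (P k.swap)) {L b : ℕ} (hL : 0 < L)
    (hprod : ∏ k, P k ^ b = X ^ L - C (-1)) {D : Submodule F (Fin L → F)} (hD : IsNegacyclic D) :
    IsSelfDual D ↔ ∃ ε : ι → ℕ, (∀ i, ε i ≤ b) ∧
      IsGeneratorPoly (-1) D (∏ k, P k ^ Sum.elim ε (fun i => b - ε i) k) := by
  -- In `g * g.reverse` the factor `P k` has exponent `a k + a k.swap`, which must match the
  -- exponent `b` in `X ^ L + 1`.
  have hsd : ∀ a : ι ⊕ ι → ℕ, (∏ k, P k ^ a k) ∣ X ^ L - C (-1) →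
      (IsSelfDual (polyCode L (-1) (∏ k, P k ^ a k)) ↔ ∀ k, a k + a k.swap = b) := by
    intro a ha
    have h := (Associated.refl (∏ k, P k ^ a k)).mul_mul (reverse_prod_pow_associated hrev a)
    rw [isSelfDual_polyCode_iff hL (by norm_num) ha, ← hprod]
    rw [← Finset.prod_mul_distrib] at h
    simp_rw [← pow_add] at h
    rw [← funext_iff (g := fun _ => b),
      ← associated_prod_pow_iff hP hmon hinj (fun k => a k + a k.swap) (fun _ => b)]
    exact ⟨fun h' => h.symm.trans h', fun h' => h.trans h'⟩
  constructor
  · intro hself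
    obtain ⟨g, hgm, hgd, rfl⟩ := exists_isGeneratorPoly hL hD
    obtain ⟨a, ha, rfl⟩ := exists_eq_prod_pow_of_dvd Finset.univ hP hmon b hgm (hprod ▸ hgd)
    have hab := (hsd a hgd).1 hself
    refine ⟨fun i => a (Sum.inl i), fun i => ha _, ?_⟩
    have hae : Sum.elim (fun i => a (Sum.inl i)) (fun i => b - a (Sum.inl i)) = a := by
      funext k
      rcases k with i | i
      · rfl
      · have := hab (Sum.inl i)
        simp only [Sum.swap_inl] at this
        simp only [Sum.elim_inr]
        omega
    rw [hae]
    exact ⟨hgm, hgd, rfl⟩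
  · rintro ⟨ε, hε, -, hgd, rfl⟩
    rw [hsd _ hgd]
    rintro (i | i)
    · simpa using Nat.add_sub_cancel' (hε i)
    · simpa using Nat.sub_add_cancel (hε i)

end SelfDual

/-! ### The factors of `X ^ (2N) + 1` when `-1` is a square -/

section Generators

variable {F K : Type*} [Field F] [Field K] [Algebra F K]

/-- The factors `M̂_{ρ i}(βX)` and `M̂_{-ρ i}(-βX)`. -/
noncomputable def cosetFactor {N e : ℕ} (η : K) (ρ : Fin (e + 1) → ZMod N) (β : F) :
    Fin (e + 1) ⊕ Fin (e + 1) → F[X] :=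
  Sum.elim (fun i => monicHat ((cosetPoly F η (ρ i)).comp (C β * X)))
    (fun i => monicHat ((cosetPoly F η (-ρ i)).comp (C (-β) * X)))

theorem selfDualGenerator_eq_prod {N e : ℕ} (η : K) (ρ : Fin (e + 1) → ZMod N) (β : F) (b : ℕ)
    (ε : Fin (e + 1) → ℕ) : selfDualGenerator η ρ β b ε =
      ∏ k, cosetFactor η ρ β k ^ Sum.elim ε (fun i => b - ε i) k := by
  rw [Fintype.prod_sum_type, selfDualGenerator, Finset.prod_mul_distrib]
  rfl

theorem irreducible_cosetPoly {N : ℕ} [NeZero N] {η : K} (hη : IsPrimitiveRoot η N) (t : ZMod N) :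
    Irreducible (cosetPoly F η t) :=
  minpoly.irreducible ((hη.isIntegral (NeZero.pos N)).tower_top.pow _)

theorem irreducible_comp_cosetPoly {N : ℕ} [NeZero N] {η : K} (hη : IsPrimitiveRoot η N)
    (t : ZMod N) {c : F} (hc : c ≠ 0) : Irreducible ((cosetPoly F η t).comp (C c * X)) :=
  irreducible_comp_C_mul_X (irreducible_cosetPoly hη t) hc

theorem monic_cosetFactor {N e : ℕ} [NeZero N] {η : K} (hη : IsPrimitiveRoot η N)
    (ρ : Fin (e + 1) → ZMod N) {β : F} (hβ : β ≠ 0) (k : Fin (e + 1) ⊕ Fin (e + 1)) :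
    (cosetFactor η ρ β k).Monic := by
  rcases k with i | i
  · exact monic_monicHat (irreducible_comp_cosetPoly hη _ hβ).ne_zero
  · exact monic_monicHat (irreducible_comp_cosetPoly hη _ (neg_ne_zero.2 hβ)).ne_zero

theorem irreducible_cosetFactor {N e : ℕ} [NeZero N] {η : K} (hη : IsPrimitiveRoot η N)
    (ρ : Fin (e + 1) → ZMod N) {β : F} (hβ : β ≠ 0) (k : Fin (e + 1) ⊕ Fin (e + 1)) :
    Irreducible (cosetFactor η ρ β k) := by
  rcases k with i | i
  · have h := irreducible_comp_cosetPoly hη (ρ i) hβ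
    exact (associated_monicHat h.ne_zero).irreducible_iff.2 h
  · have h := irreducible_comp_cosetPoly hη (-ρ i) (neg_ne_zero.2 hβ)
    exact (associated_monicHat h.ne_zero).irreducible_iff.2 h

theorem aeval_monicHat_comp_eq_zero {N : ℕ} {η : K} {t : ZMod N} {c : F} {x : K}
    (hx : algebraMap F K c * x = η ^ t.val) :
    aeval x (monicHat ((cosetPoly F η t).comp (C c * X))) = 0 := by
  rw [monicHat, map_mul, aeval_comp, map_mul, aeval_C, aeval_C, aeval_X, hx,
    cosetPoly, minpoly.aeval, mul_zero]

theorem associated_reverse_cosetFactor {N e : ℕ} [NeZero N] {η : K} (hη : IsPrimitiveRoot η N)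
    (ρ : Fin (e + 1) → ZMod N) {β : F} (hβ : β * β = -1) (k : Fin (e + 1) ⊕ Fin (e + 1)) :
    Associated (cosetFactor η ρ β k).reverse (cosetFactor η ρ β k.swap) := by
  have hβ0 : β ≠ 0 := by
    rintro rfl
    simp at hβ
  have hη0 : η ≠ 0 := hη.ne_zero (NeZero.ne N)
  have hβK : algebraMap F K β * algebraMap F K β = -1 := by
    rw [← map_mul, hβ, map_neg, map_one]
  have hβK0 : algebraMap F K β ≠ 0 := (_root_.map_ne_zero _).2 hβ0
  have hneg : ∀ i, η ^ (-ρ i).val = (η ^ (ρ i).val)⁻¹ := by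
    intro i
    have h : η ^ ((-ρ i).val + (ρ i).val) = η ^ 0 := by
      have := (hη.pow_val_eq_pow_iff 0 ((-ρ i).val + (ρ i).val)).2 (by simp)
      rw [← this, ZMod.val_zero]
    rw [pow_add, pow_zero] at h
    exact eq_inv_of_mul_eq_one_left h
  -- The root comes from `β * (-β) = 1`.
  have h1 : ∀ i, aeval (-(algebraMap F K β * η ^ (ρ i).val)) (cosetFactor η ρ β (Sum.inl i)) = 0 :=
    fun i => aeval_monicHat_comp_eq_zero (by linear_combination -(η ^ (ρ i).val) * hβK)
  have h2 : ∀ i, aeval (-(algebraMap F K β * η ^ (ρ i).val))⁻¹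
      (cosetFactor η ρ β (Sum.inr i)) = 0 := by
    intro i
    refine aeval_monicHat_comp_eq_zero ?_
    rw [hneg, map_neg, inv_neg, neg_mul_neg, mul_inv, ← mul_assoc, mul_inv_cancel₀ hβK0, one_mul]
  have h0 : ∀ i, -(algebraMap F K β * η ^ (ρ i).val) ≠ 0 :=
    fun i => neg_ne_zero.2 (mul_ne_zero hβK0 (pow_ne_zero _ hη0))
  have hirr := irreducible_cosetFactor hη ρ hβ0
  rcases k with i | i
  · exact associated_reverse_of_aeval_inv (hirr _) (hirr _) (h0 i) (h1 i) (h2 i)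
  · exact associated_reverse_of_aeval_inv (hirr _) (hirr _) (inv_ne_zero (h0 i)) (h2 i)
      (by rw [inv_inv]; exact h1 i)

/-- As `N` is odd, replacing `β` by `-β` changes the sign of `δ = (β ^ N)⁻¹`, and `δ ^ 2 = -1`. The
two families therefore multiply to `X ^ N - δ` and `X ^ N + δ`. -/
theorem prod_cosetFactor [Fintype F] {N e : ℕ} [NeZero N] (hN : Odd N) {η : K}
    (hη : IsPrimitiveRoot η N) {ρ : Fin (e + 1) → ZMod N}
    (hρ : IsCosetSystem (Fintype.card F) N ρ) {β : F} (hβ : β * β = -1) :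
    ∏ k, cosetFactor η ρ β k = X ^ (2 * N) - C (-1) := by
  have hβ0 : β ≠ 0 := by
    rintro rfl
    simp at hβ
  have hβN : β ^ N ≠ 0 := pow_ne_zero _ hβ0
  have h1 := associated_prod_monicHat_comp (fun i => irreducible_cosetPoly hη (ρ i))
    (prod_cosetPoly hη hρ) (mul_inv_cancel₀ hβN) hβ0
  have h2 := associated_prod_monicHat_comp (fun i => irreducible_cosetPoly hη (-ρ i))
    (prod_cosetPoly hη hρ.neg) (d := -(β ^ N)⁻¹)
    (by rw [hN.neg_pow, neg_mul_neg, mul_inv_cancel₀ hβN]) (neg_ne_zero.2 hβ0)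
  refine eq_of_monic_of_associated
    (monic_prod_of_monic _ _ fun k _ => monic_cosetFactor hη ρ hβ0 k)
    (monic_X_pow_sub_C _ (mul_ne_zero two_ne_zero (NeZero.ne N))) ?_
  have hsq : (β ^ N)⁻¹ * (β ^ N)⁻¹ = -1 := by
    rw [← mul_inv, ← mul_pow, hβ, hN.neg_one_pow, inv_neg, inv_one]
  have hfac : (X ^ (2 * N) - C (-1) : F[X]) =
      (X ^ N - C (β ^ N)⁻¹) * (X ^ N - C (-(β ^ N)⁻¹)) := by
    rw [← hsq, C_mul, C_neg, mul_comm 2 N, pow_mul]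
    ring
  rw [Fintype.prod_sum_type, hfac]
  exact h1.mul_mul h2

/-! ### Classification and count of the self-dual codes -/

section Classification

variable [Fintype F] {N e p n : ℕ} [NeZero N] [CharP F p]

theorem injective_cosetFactor (hp2 : p ≠ 2) (hN : Odd N) (hNF : (N : F) ≠ 0) {η : K}
    (hη : IsPrimitiveRoot η N) {ρ : Fin (e + 1) → ZMod N}
    (hρ : IsCosetSystem (Fintype.card F) N ρ) {β : F} (hβ : β * β = -1) (hβ0 : β ≠ 0) :
    Function.Injective (cosetFactor η ρ β) := by
  refine injective_of_squarefree_prod (irreducible_cosetFactor hη ρ hβ0) ?_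
  rw [prod_cosetFactor hN hη hρ hβ]
  exact squarefree_X_pow_sub_C_neg_one (two_mul_cast_ne_zero hp2 hNF)

theorem selfDualGenerator_injective (hp2 : p ≠ 2) (hN : Odd N) (hNF : (N : F) ≠ 0)
    {η : K} (hη : IsPrimitiveRoot η N) {ρ : Fin (e + 1) → ZMod N}
    (hρ : IsCosetSystem (Fintype.card F) N ρ) {β : F} (hβ : β * β = -1) (hβ0 : β ≠ 0) (b : ℕ) :
    Function.Injective (selfDualGenerator η ρ β b) := by
  intro ε ε' h
  rw [selfDualGenerator_eq_prod, selfDualGenerator_eq_prod] at h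
  have := (associated_prod_pow_iff (irreducible_cosetFactor hη ρ hβ0) (monic_cosetFactor hη ρ hβ0)
    (injective_cosetFactor hp2 hN hNF hη hρ hβ hβ0) _ _).1 (.of_eq h)
  funext i
  -- The left exponents are `ε` itself, so the truncation of `b - ε i` does no harm and no bound on
  -- `ε` is needed.
  exact congrFun this (Sum.inl i)

variable [Fact p.Prime]

theorem isSelfDual_iff_exists_selfDualGenerator (hp2 : p ≠ 2) (hN : Odd N) (hNF : (N : F) ≠ 0)
    {η : K} (hη : IsPrimitiveRoot η N) {ρ : Fin (e + 1) → ZMod N}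
    (hρ : IsCosetSystem (Fintype.card F) N ρ) {β : F} (hβ : β * β = -1) (hβ0 : β ≠ 0)
    {D : Submodule F (Fin (2 * N * p ^ n) → F)} (hD : IsNegacyclic D) :
    IsSelfDual D ↔ ∃ ε : Fin (e + 1) → ℕ, (∀ i, ε i ≤ p ^ n) ∧
      IsGeneratorPoly (-1) D (selfDualGenerator η ρ β (p ^ n) ε) := by
  simp_rw [selfDualGenerator_eq_prod]
  refine isSelfDual_iff_exists_exponents (irreducible_cosetFactor hη ρ hβ0)
    (monic_cosetFactor hη ρ hβ0) (injective_cosetFactor hp2 hN hNF hη hρ hβ hβ0)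
    (associated_reverse_cosetFactor hη ρ hβ) (length_pos hN) ?_ hD
  rw [Finset.prod_pow, prod_cosetFactor hN hη hρ hβ, X_pow_sub_C_neg_one_pow hp2]

theorem isGeneratorPoly_selfDualGenerator (hp2 : p ≠ 2) (hN : Odd N)
    {η : K} (hη : IsPrimitiveRoot η N) {ρ : Fin (e + 1) → ZMod N}
    (hρ : IsCosetSystem (Fintype.card F) N ρ) {β : F} (hβ : β * β = -1) (hβ0 : β ≠ 0)
    {ε : Fin (e + 1) → ℕ} (hε : ∀ i, ε i ≤ p ^ n) :
    IsGeneratorPoly (-1) (polyCode (2 * N * p ^ n) (-1) (selfDualGenerator η ρ β (p ^ n) ε))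
      (selfDualGenerator η ρ β (p ^ n) ε) := by
  rw [selfDualGenerator_eq_prod]
  refine ⟨monic_prod_of_monic _ _ fun k _ => (monic_cosetFactor hη ρ hβ0 k).pow _, ?_, rfl⟩
  rw [← X_pow_sub_C_neg_one_pow hp2, ← prod_cosetFactor hN hη hρ hβ, ← Finset.prod_pow]
  refine Finset.prod_dvd_prod_of_dvd _ _ fun k _ => pow_dvd_pow _ ?_
  rcases k with i | i
  · exact hε i
  · exact Nat.sub_le _ _

theorem ncard_selfDual (hp2 : p ≠ 2) (hN : Odd N) (hNF : (N : F) ≠ 0)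
    {η : K} (hη : IsPrimitiveRoot η N) {ρ : Fin (e + 1) → ZMod N}
    (hρ : IsCosetSystem (Fintype.card F) N ρ) {β : F} (hβ : β * β = -1) (hβ0 : β ≠ 0) :
    {D : Submodule F (Fin (2 * N * p ^ n) → F) | IsNegacyclic D ∧ IsSelfDual D}.ncard =
      (p ^ n + 1) ^ (e + 1) := by
  let φ : (Fin (e + 1) → Fin (p ^ n + 1)) → Submodule F (Fin (2 * N * p ^ n) → F) :=
    fun ε => polyCode _ (-1) (selfDualGenerator η ρ β (p ^ n) fun i => ε i)
  have hL : 0 < 2 * N * p ^ n := length_pos hN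
  have hgen : ∀ ε : Fin (e + 1) → Fin (p ^ n + 1),
      IsGeneratorPoly (-1) (φ ε) (selfDualGenerator η ρ β (p ^ n) fun i => ε i) := fun ε =>
    isGeneratorPoly_selfDualGenerator hp2 hN hη hρ hβ hβ0 fun i => Nat.le_of_lt_succ (ε i).isLt
  have hφ : Function.Injective φ := by
    intro ε ε' h
    have h1 := eq_of_isGeneratorPoly hL (hgen ε) (h ▸ hgen ε')
    funext i
    exact Fin.ext (congrFun (selfDualGenerator_injective hp2 hN hNF hη hρ hβ hβ0 _ h1) i)
  have hset : {D : Submodule F (Fin (2 * N * p ^ n) → F) | IsNegacyclic D ∧ IsSelfDual D} =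
      φ '' Set.univ := by
    ext D
    simp only [Set.mem_ofPred_eq, Set.image_univ, Set.mem_range]
    constructor
    · rintro ⟨hD, hs⟩
      obtain ⟨ε, hε, -, -, rfl⟩ :=
        (isSelfDual_iff_exists_selfDualGenerator hp2 hN hNF hη hρ hβ hβ0 hD).1 hs
      exact ⟨fun i => ⟨ε i, Nat.lt_succ_of_le (hε i)⟩, rfl⟩
    · rintro ⟨ε, rfl⟩
      have hD : IsNegacyclic (φ ε) := isConstacyclic_polyCode hL (hgen ε).2.1
      exact ⟨hD, (isSelfDual_iff_exists_selfDualGenerator hp2 hN hNF hη hρ hβ hβ0 hD).2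
        ⟨_, fun i => Nat.le_of_lt_succ (ε i).isLt, hgen ε⟩⟩
  rw [hset, Set.ncard_image_of_injective _ hφ, Set.ncard_univ]
  simp

end Classification

end Generators

theorem mainTheorem7 {F K : Type*} [Field F] [Fintype F] [Field K] [Algebra F K]
    (p l m n : ℕ) (hp : p.Prime) (hp2 : p ≠ 2) [CharP F p]
    (hl : l.Prime) (hl2 : l ≠ 2) (hlp : l ≠ p) (hm : 1 ≤ m) :
    (Fintype.card F ≡ 1 [MOD 4] →
      {D : Submodule F (Fin (2 * l ^ m * p ^ n) → F) | IsNegacyclic D ∧ IsSelfDual D}.ncard =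
          (p ^ n + 1) ^ (nonzeroCosetCount (Fintype.card F) (l ^ m) + 1) ∧
      (∃ γ β : F, IsPrimitiveRoot γ 4 ∧ β ^ (l ^ m) * γ = 1 ∧ β⁻¹ = -β) ∧
      ∀ (η : K) (ρ : Fin (nonzeroCosetCount (Fintype.card F) (l ^ m) + 1) → ZMod (l ^ m))
        (γ β : F), IsPrimitiveRoot η (l ^ m) → IsCosetSystem (Fintype.card F) (l ^ m) ρ →
        IsPrimitiveRoot γ 4 → β ^ (l ^ m) * γ = 1 → β⁻¹ = -β →
        (∀ ε : Fin (nonzeroCosetCount (Fintype.card F) (l ^ m) + 1) → ℕ, (∀ i, ε i ≤ p ^ n) →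
          ∃ D : Submodule F (Fin (2 * l ^ m * p ^ n) → F), IsNegacyclic D ∧ IsSelfDual D ∧
            IsGeneratorPoly (-1) D (selfDualGenerator η ρ β (p ^ n) ε)) ∧
        (∀ D : Submodule F (Fin (2 * l ^ m * p ^ n) → F), IsNegacyclic D → IsSelfDual D →
          ∃! ε : Fin (nonzeroCosetCount (Fintype.card F) (l ^ m) + 1) → ℕ,
            (∀ i, ε i ≤ p ^ n) ∧
            IsGeneratorPoly (-1) D (selfDualGenerator η ρ β (p ^ n) ε))) ∧
    (Fintype.card F ≡ 3 [MOD 4] →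
      ¬ ∃ D : Submodule F (Fin (2 * l ^ m * p ^ n) → F), IsNegacyclic D ∧ IsSelfDual D) := by
  have hpF : Fact p.Prime := ⟨hp⟩
  have hNodd : Odd (l ^ m) := (hl.odd_of_ne_two hl2).pow
  have hN0 : NeZero (l ^ m) := ⟨pow_ne_zero _ hl.ne_zero⟩
  have hNF : ((l ^ m : ℕ) : F) ≠ 0 := by
    rw [Ne, CharP.cast_eq_zero_iff F p]
    exact fun h => hlp ((Nat.prime_dvd_prime_iff_eq hp hl).1 (hp.dvd_of_dvd_pow h)).symm
  have hL : 0 < 2 * l ^ m * p ^ n := length_pos hNodd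
  refine ⟨fun hq => ?_, fun hq => ?_⟩
  · obtain ⟨β, hβ⟩ : IsSquare (-1 : F) := FiniteField.isSquare_neg_one_iff.2 (by
      rw [hq]
      decide)
    have hβ' : β * β = -1 := hβ.symm
    have hβ0 : β ≠ 0 := by
      rintro rfl
      simp at hβ
    refine ⟨?_, ?_, ?_⟩
    -- The count does not mention `η`, and `K` may contain no primitive root, so one is taken from
    -- the algebraic closure.
    · have hNF' : NeZero ((l ^ m : ℕ) : AlgebraicClosure F) :=
        ⟨by rw [← map_natCast (algebraMap F _)]; exact (_root_.map_ne_zero _).2 hNF⟩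
      obtain ⟨η, hη⟩ := HasEnoughRootsOfUnity.exists_primitiveRoot (AlgebraicClosure F) (l ^ m)
      have hcop : (Fintype.card F).Coprime (l ^ m) := by
        obtain ⟨k, -, hk⟩ := FiniteField.card F p
        rw [hk]
        exact Nat.Coprime.pow _ _ ((Nat.coprime_primes hp hl).2 hlp.symm)
      obtain ⟨ρ, hρ⟩ := exists_isCosetSystem hcop
      exact ncard_selfDual hp2 hNodd hNF hη hρ hβ' hβ0
    · have hinv : (β ^ l ^ m)⁻¹ * (β ^ l ^ m)⁻¹ = -1 := by
        rw [← mul_inv, ← mul_pow, hβ', hNodd.neg_one_pow, inv_neg, inv_one]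
      have hne : (-1 : F) ≠ 1 := Ring.neg_one_ne_one_of_char_ne_two (by rwa [ringChar.eq F p])
      refine ⟨(β ^ l ^ m)⁻¹, β, ?_, mul_inv_cancel₀ (pow_ne_zero _ hβ0),
        -- Any square root `β` of `-1` works: `γ = (β ^ l ^ m)⁻¹` is forced, and it has order 4
        -- because its square is `-1 ≠ 1`.
        inv_eq_of_mul_eq_one_right (by rw [mul_neg, hβ', neg_neg])⟩
      refine IsPrimitiveRoot.iff_orderOf.2 (orderOf_eq_prime_pow (p := 2) (n := 1) ?_ ?_)
      · rwa [pow_one, sq, hinv]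
      · rw [show 2 ^ (1 + 1) = 2 * 2 from rfl, pow_mul, sq (β ^ l ^ m)⁻¹, hinv,
          neg_one_sq]
    · intro η ρ γ β hη hρ _ hβγ hβ
      have hβ0 : β ≠ 0 := by
        rintro rfl
        rw [zero_pow hN0.out, zero_mul] at hβγ
        exact zero_ne_one hβγ
      have hβ' : β * β = -1 := by
        rw [← neg_eq_iff_eq_neg, ← mul_neg, ← hβ, mul_inv_cancel₀ hβ0]
      refine ⟨fun ε hε => ?_, fun D hD hs => ?_⟩
      · have hgen := isGeneratorPoly_selfDualGenerator hp2 hNodd hη hρ hβ' hβ0 hε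
        have hD := isConstacyclic_polyCode hL hgen.2.1
        exact ⟨_, hD, (isSelfDual_iff_exists_selfDualGenerator hp2 hNodd hNF hη hρ hβ' hβ0 hD).2
          ⟨ε, hε, hgen⟩, hgen⟩
      · obtain ⟨ε, hε, hgen⟩ :=
          (isSelfDual_iff_exists_selfDualGenerator hp2 hNodd hNF hη hρ hβ' hβ0 hD).1 hs
        exact ⟨ε, ⟨hε, hgen⟩, fun ε' h' => selfDualGenerator_injective hp2 hNodd hNF hη hρ hβ' hβ0 _
          (eq_of_isGeneratorPoly hL h'.2 hgen)⟩
  · rintro ⟨D, hD, hs⟩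
    refine not_isSelfDual_of_not_isSquare hp2 hNodd hNF (fun h => ?_) hD hs
    exact FiniteField.isSquare_neg_one_iff.1 h hq
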